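/- \textbf{Theorem (ADF--SOL Interpretation).} \emph{Syntax.} Fix a relational signature $L$ and a set of variables. ADF formulae are given by $\varphi ::= \bot \mid \top \mid x=y \mid P(\vec x) \mid \neg\varphi \mid \varphi\wedge\varphi \mid \varphi\vee\varphi \mid \exists_{+W}x.\varphi \mid \forall_{+W}x.\varphi$, where $P\in L$ and $W$ is a finite set of variables (those that the value of $x$ may depend on). The set $\mathrm{free}(\varphi)$ is defined as usual, except that, for $Q\in\{\exists,\forall\}$, $\mathrm{free}(Q_{+W}x.\varphi)=(\mathrm{free}(\varphi)\setminus\{x\})\cup W$ if $x\in\mathrm{free}(\varphi)$, and $\mathrm{free}(Q_{+W}x.\varphi)=\mathrm{free}(\varphi)$ otherwise. \emph{Hyperteams.} Let $A$ be an $L$-structure with non-empty domain, also denoted $A$. An assignment is a partial function from variables to $A$; a hyperteam over a set $V$ of variables is a set of sets ("teams") of assignments with domain $V$; it is null if it contains the empty team. The dual $\overline{X}$ of a hyperteam $X$ is the set of the images $\{c(T): T\in X\}$ of all functions $c$ on $X$ with $c(T)\in T$ for all $T\in X$. The extension $\mathrm{ext}_W(X,x)$ is the set of all teams $\{s[x\mapsto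 F(s)] : s\in T\}$ with $T\in X$ and $F$ a function from assignments to $A$ such that $F(s)=F(s{\restriction}W)$ for all assignments $s$. \emph{Semantics.} For the flags $\alpha\in\{\exists\forall,\forall\exists\}$ the relation $A,X\models^\alpha\varphi$ is defined recursively. \begin{itemize} \item $A,X\models^{\exists\forall}\bot$ iff $\emptyset\in X$; $A,X\models^{\forall\exists}\bot$ iff $X=\emptyset$; $A,X\models^{\exists\forall}\top$ iff $X\neq\emptyset$; $A,X\models^{\forall\exists}\top$ iff $\emptyset\notin X$. \item For an atom $\beta$: $A,X\models^{\exists\forall}\beta$ iff some team of $X$ has only assignments that satisfy $\beta$ in $A$; $A,X\models^{\forall\exists}\beta$ iff every team of $X$ has an assignment that satisfies $\beta$ in $A$. \item $A,X\models^{\alpha}\neg\varphi$ iff not $A,X\models^{\overline\alpha}\varphi$, where $\overline\alpha$ is the other flag. \item $A,X\models^{\exists\forall}\varphi_1\wedge\varphi_2$ iff, for every partition of $X$ into two (possibly empty) parts $X_1,X_2$, $A,X_1\models^{\exists\forall}\varphi_1$ or $A,X_2\models^{\exists\forall}\varphi_2$; $A,X\models^{\forall\exists}\varphi_1\wedge\varphi_2$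 iff $A,\overline X\models^{\exists\forall}\varphi_1\wedge\varphi_2$. \item $A,X\models^{\forall\exists}\varphi_1\vee\varphi_2$ iff, for some partition of $X$ into two (possibly empty) parts $X_1,X_2$, $A,X_1\models^{\forall\exists}\varphi_1$ and $A,X_2\models^{\forall\exists}\varphi_2$; $A,X\models^{\exists\forall}\varphi_1\vee\varphi_2$ iff $A,\overline X\models^{\forall\exists}\varphi_1\vee\varphi_2$. \item $A,X\models^{\exists\forall}\exists_{+W}x.\varphi$ iff $A,\mathrm{ext}_W(X,x)\models^{\exists\forall}\varphi$; $A,X\models^{\forall\exists}\exists_{+W}x.\varphi$ iff $A,\overline X\models^{\exists\forall}\exists_{+W}x.\varphi$. \item $A,X\models^{\forall\exists}\forall_{+W}x.\varphi$ iff $A,\mathrm{ext}_W(X,x)\models^{\forall\exists}\varphi$; $A,X\models^{\exists\forall}\forall_{+W}x.\varphi$ iff $A,\overline X\models^{\forall\exists}\forall_{+W}x.\varphi$. \end{itemize} \emph{Relational encoding.} Let $V=\{x_1,\dots,x_n\}$ be a finite set of variables, listed without repetition. A relation $R_X\subseteq A^{n+1}$ encodes the hyperteam $X$ over $V$ if every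 team of $X$ is coded by some $a\in A$ and, for $X\neq\emptyset$, every $a\in A$ codes a team of $X$, where $a$ codes $T$ if, for all assignments $s$ with domain $V$, $s\in T$ iff $(s(x_1),\dots,s(x_n),a)\in R_X$; the empty hyperteam is encoded by $R_X=\emptyset$ only. \emph{Claim.} Let $\varphi=Q_1{}_{+W_1}z_1\cdots Q_k{}_{+W_k}z_k.\,\psi$ be a prenex ADF formula over $L$ with $\psi$ quantifier-free, the $z_i$ pairwise distinct, and $z_j\notin W_i$ for all $i\le j$. Let $V=\{x_1,\dots,x_n\}$ be a finite set of variables (listed without repetition) with $\mathrm{free}(\varphi)\subseteq V$ and $z_i\notin V$ for all $i$, and let $R\notin L$ be a relation symbol of arity $n+1$. Then there are two sentences $\Phi_{\exists\forall}$ and $\Phi_{\forall\exists}$ of second-order logic (full semantics, with quantification over individuals, functions and relations) over $L\uplus\{R\}$ such that, for all $L$-structures $A$ with non-empty domain and all non-null hyperteams $X$ over $V$ with $|X|\le|A|$: $X$ has a relational encoding, and, for every relational encoding $R_X$ of $X$ and every $\alpha\in\{\exists\forall,\forall\exists\}$, $$A,X\models^{\alpha}\varphi \iff A\uplus\{R_X\}\models\Phi_\alpha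 .$$ -/

import Mathlib

universe uA uV uF uR


namespace ADFLogic

/-! ### Syntax of ADF -/

/-- The two quantifier symbols. -/
inductive Quant : Type
  | exist
  | univ

/-- Formulae of the dependence fragment ADF over the relational signature `L`, with variables in
`Var`. `quant q W x φ` is the restricted quantification `Q_{+W} x. φ` of `x`, where `W` is the
finite set of the variables that the value of `x` may depend on. Equality is the interpreted
relation `eq`. -/
inductive ADFFormula (L : FirstOrder.Language.{uF, uR}) (Var : Type uV) : Type (max uR uV)
  | bot : ADFFormula L Var
  | top : ADFFormula L Var
  | eq (x y : Var) : ADFFormula L Var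
  | rel {n : ℕ} (r : L.Relations n) (x : Fin n → Var) : ADFFormula L Var
  | neg (φ : ADFFormula L Var) : ADFFormula L Var
  | and (φ ψ : ADFFormula L Var) : ADFFormula L Var
  | or (φ ψ : ADFFormula L Var) : ADFFormula L Var
  | quant (q : Quant) (W : Finset Var) (x : Var) (φ : ADFFormula L Var) : ADFFormula L Var

namespace ADFFormula

variable {L : FirstOrder.Language.{uF, uR}} {Var : Type uV}

/-- The free variables of an ADF formula. A constraint set contributes to them only when the
quantified variable is itself free in the matrix. -/
def free [DecidableEq Var] : ADFFormula L Var → Finset Var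
  | bot => ∅
  | top => ∅
  | eq x y => {x, y}
  | rel _ x => Finset.image x Finset.univ
  | neg φ => φ.free
  | and φ ψ => φ.free ∪ ψ.free
  | or φ ψ => φ.free ∪ ψ.free
  | quant _ W x φ => if x ∈ φ.free then (φ.free \ {x}) ∪ W else φ.free

/-- The formula contains no quantifier. -/
def IsQuantifierFree : ADFFormula L Var → Prop
  | bot => True
  | top => True
  | eq _ _ => True
  | rel _ _ => True
  | neg φ => φ.IsQuantifierFree
  | and φ ψ => φ.IsQuantifierFree ∧ ψ.IsQuantifierFree
  | or φ ψ => φ.IsQuantifierFree ∧ ψ.IsQuantifierFree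
  | quant _ _ _ _ => False

end ADFFormula

/-- One entry `Q_{+W} x` of a quantifier prefix. -/
structure QuantEntry (Var : Type uV) : Type uV where
  q : Quant
  W : Finset Var
  x : Var

/-- `prenex p φ` is the formula with the quantifier prefix `p`, read from left to right
(outermost quantifier first), and the matrix `φ`. -/
def prenex {L : FirstOrder.Language.{uF, uR}} {Var : Type uV} :
    List (QuantEntry Var) → ADFFormula L Var → ADFFormula L Var
  | [], φ => φ
  | e :: p, φ => .quant e.q e.W e.x (prenex p φ)

/-- The conditions on quantifier prefixes: each variable is quantified at most once, does not
occur in the constraint set of its own quantifier, and is not quantified in the scope of a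
quantifier whose constraint set contains it. -/
structure AdmissiblePref {Var : Type uV} (p : List (QuantEntry Var)) : Prop where
  nodup : (p.map QuantEntry.x).Nodup
  notMem_self : ∀ e ∈ p, e.x ∉ e.W
  notMem_scope : p.Pairwise fun e e' => e'.x ∉ e.W

/-! ### Assignments, teams and hyperteams -/

/-- Partial assignments of values in `A` to variables. -/
abbrev Asg (Var : Type uV) (A : Type uA) : Type (max uV uA) := Var → Option A

/-- Sets of assignments. -/
abbrev Team (Var : Type uV) (A : Type uA) : Type (max uV uA) := Set (Asg Var A)

/-- Sets of teams. -/
abbrev Hyperteam (Var : Type uV) (A : Type uA) : Type (max uV uA) := Set (Team Var A)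

section Hyperteams

variable {Var : Type uV} {A : Type uA}

/-- The domain of a partial assignment. -/
def Asg.dom (s : Asg Var A) : Set Var := {x | s x ≠ none}

open Classical in
/-- The restriction of an assignment to the variables in `W`. -/
noncomputable def Asg.restrict (s : Asg Var A) (W : Set Var) : Asg Var A :=
  fun x => if x ∈ W then s x else none

open Classical in
/-- The assignment `s[x ↦ a]`. -/
noncomputable def Asg.update (s : Asg Var A) (x : Var) (a : A) : Asg Var A :=
  Function.update s x (some a)

/-- `H` is a hyperteam over the set of variables `V`. -/
def Hyperteam.Over (H : Hyperteam Var A) (V : Set Var) : Prop :=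
  ∀ X ∈ H, ∀ s ∈ X, Asg.dom s = V

/-- The dual hyperteam: the set of the images of all choice functions. -/
def Hyperteam.dual (H : Hyperteam Var A) : Hyperteam Var A :=
  {Y | ∃ c : H → Asg Var A, (∀ X : H, c X ∈ (X : Team Var A)) ∧ Y = Set.range c}

/-- `F` is a `W`-uniform function from assignments to values. -/
def Uniform (W : Set Var) (F : Asg Var A → A) : Prop :=
  ∀ s : Asg Var A, F s = F (s.restrict W)

/-- The extension of a team for the variable `x` by the function `F`. -/
noncomputable def Team.ext (X : Team Var A) (F : Asg Var A → A) (x : Var) : Team Var A :=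
  (fun s => Asg.update s x (F s)) '' X

/-- The extension of a hyperteam for the variable `x` by all `W`-uniform functions. -/
noncomputable def Hyperteam.ext (H : Hyperteam Var A) (W : Set Var) (x : Var) :
    Hyperteam Var A :=
  {Y | ∃ X ∈ H, ∃ F : Asg Var A → A, Uniform W F ∧ Y = Team.ext X F x}

/-- `(H₁, H₂)` is a bipartition of `H`. -/
def IsBipartition (H H₁ H₂ : Hyperteam Var A) : Prop :=
  H₁ ∩ H₂ = ∅ ∧ H₁ ∪ H₂ = H

end Hyperteams

/-! ### Semantics of ADF -/

/-- Alternation flags: `ea` is `∃∀` and `ae` is `∀∃`. -/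
inductive AltFlag : Type
  | ea
  | ae

/-- The dual flag. -/
def AltFlag.dual : AltFlag → AltFlag
  | .ea => .ae
  | .ae => .ea

/-- Hodges' alternating satisfaction relation `A, H ⊨^α φ`. In the clauses where the flag is not
the one coherent with the main symbol, the clause of the other flag is used on the dual
hyperteam. -/
def Sat {L : FirstOrder.Language.{uF, uR}} {Var : Type uV} {A : Type uA} [L.Structure A] :
    ADFFormula L Var → AltFlag → Hyperteam Var A → Prop
  | .bot, .ea, H => ∅ ∈ H
  | .bot, .ae, H => H = ∅
  | .top, .ea, H => H ≠ ∅
  | .top, .ae, H => ∅ ∉ H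
  | .eq x y, .ea, H => ∃ X ∈ H, ∀ s ∈ X, ∃ a : A, s x = some a ∧ s y = some a
  | .eq x y, .ae, H => ∀ X ∈ H, ∃ s ∈ X, ∃ a : A, s x = some a ∧ s y = some a
  | .rel (n := n) r x, .ea, H =>
      ∃ X ∈ H, ∀ s ∈ X, ∃ v : Fin n → A,
        (∀ i, s (x i) = some (v i)) ∧ FirstOrder.Language.Structure.RelMap r v
  | .rel (n := n) r x, .ae, H =>
      ∀ X ∈ H, ∃ s ∈ X, ∃ v : Fin n → A,
        (∀ i, s (x i) = some (v i)) ∧ FirstOrder.Language.Structure.RelMap r v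
  | .neg φ, α, H => ¬ Sat φ α.dual H
  | .and φ ψ, .ea, H => ∀ H₁ H₂, IsBipartition H H₁ H₂ → Sat φ .ea H₁ ∨ Sat ψ .ea H₂
  | .and φ ψ, .ae, H => ∀ H₁ H₂, IsBipartition H.dual H₁ H₂ → Sat φ .ea H₁ ∨ Sat ψ .ea H₂
  | .or φ ψ, .ea, H => ∃ H₁ H₂, IsBipartition H.dual H₁ H₂ ∧ Sat φ .ae H₁ ∧ Sat ψ .ae H₂
  | .or φ ψ, .ae, H => ∃ H₁ H₂, IsBipartition H H₁ H₂ ∧ Sat φ .ae H₁ ∧ Sat ψ .ae H₂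
  | .quant .exist W x φ, .ea, H => Sat φ .ea (H.ext W x)
  | .quant .exist W x φ, .ae, H => Sat φ .ea (H.dual.ext W x)
  | .quant .univ W x φ, .ea, H => Sat φ .ae (H.dual.ext W x)
  | .quant .univ W x φ, .ae, H => Sat φ .ae (H.ext W x)

/-! ### Second-order logic -/

/-- Terms of second-order logic: individual variables, symbols of the signature, and function
variables; `app n F` is the function variable of arity `n` with the name `F`. -/
inductive SOTerm (L : FirstOrder.Language.{uF, uR}) : Type uF
  | var (x : ℕ) : SOTerm L
  | func {n : ℕ} (f : L.Functions n) (t : Fin n → SOTerm L) : SOTerm L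
  | app (n F : ℕ) (t : Fin n → SOTerm L) : SOTerm L

/-- Formulae of second-order logic, with quantification over individuals, over functions
(`allFun n F`, `exFun n F`) and over relations (`allRel n R`, `exRel n R`) of every arity `n`. -/
inductive SOFormula (L : FirstOrder.Language.{uF, uR}) : Type (max uF uR)
  | bot : SOFormula L
  | eq (t u : SOTerm L) : SOFormula L
  | rel {n : ℕ} (r : L.Relations n) (t : Fin n → SOTerm L) : SOFormula L
  | relVar (n R : ℕ) (t : Fin n → SOTerm L) : SOFormula L
  | neg (φ : SOFormula L) : SOFormula L
  | and (φ ψ : SOFormula L) : SOFormula L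
  | or (φ ψ : SOFormula L) : SOFormula L
  | ex (x : ℕ) (φ : SOFormula L) : SOFormula L
  | all (x : ℕ) (φ : SOFormula L) : SOFormula L
  | exFun (n F : ℕ) (φ : SOFormula L) : SOFormula L
  | allFun (n F : ℕ) (φ : SOFormula L) : SOFormula L
  | exRel (n R : ℕ) (φ : SOFormula L) : SOFormula L
  | allRel (n R : ℕ) (φ : SOFormula L) : SOFormula L

/-- The variables of second-order logic, of all sorts; the first argument of `func` and of `rel`
is the arity. -/
inductive SOVar : Type
  | ind (x : ℕ)
  | func (n F : ℕ)
  | rel (n R : ℕ)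

/-- The variables of a term. -/
def SOTerm.vars {L : FirstOrder.Language.{uF, uR}} : SOTerm L → Set SOVar
  | .var x => {.ind x}
  | .func _ t => ⋃ i, (t i).vars
  | .app n F t => {.func n F} ∪ ⋃ i, (t i).vars

/-- The free variables, of all sorts, of a formula of second-order logic. -/
def SOFormula.freeVars {L : FirstOrder.Language.{uF, uR}} : SOFormula L → Set SOVar
  | .bot => ∅
  | .eq t u => t.vars ∪ u.vars
  | .rel _ t => ⋃ i, (t i).vars
  | .relVar n R t => {.rel n R} ∪ ⋃ i, (t i).vars
  | .neg φ => φ.freeVars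
  | .and φ ψ => φ.freeVars ∪ ψ.freeVars
  | .or φ ψ => φ.freeVars ∪ ψ.freeVars
  | .ex x φ => φ.freeVars \ {.ind x}
  | .all x φ => φ.freeVars \ {.ind x}
  | .exFun n F φ => φ.freeVars \ {.func n F}
  | .allFun n F φ => φ.freeVars \ {.func n F}
  | .exRel n R φ => φ.freeVars \ {.rel n R}
  | .allRel n R φ => φ.freeVars \ {.rel n R}

/-- Sentences of second-order logic. -/
def SOSentence (L : FirstOrder.Language.{uF, uR}) : Type (max uF uR) :=
  {φ : SOFormula L // φ.freeVars = ∅}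

/-- An environment assigns a value to each individual, function and relation variable. -/
structure SOEnv (A : Type uA) : Type uA where
  ind : ℕ → A
  func : (n : ℕ) → ℕ → (Fin n → A) → A
  rel : (n : ℕ) → ℕ → Set (Fin n → A)

namespace SOEnv

variable {A : Type uA}

/-- Change the value of an individual variable. -/
def setInd (e : SOEnv A) (x : ℕ) (a : A) : SOEnv A :=
  { e with ind := Function.update e.ind x a }

/-- Change the value of a function variable. -/
def setFunc (e : SOEnv A) (n F : ℕ) (f : (Fin n → A) → A) : SOEnv A :=
  { e with func := Function.update e.func n (Function.update (e.func n) F f) }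

/-- Change the value of a relation variable. -/
def setRel (e : SOEnv A) (n R : ℕ) (r : Set (Fin n → A)) : SOEnv A :=
  { e with rel := Function.update e.rel n (Function.update (e.rel n) R r) }

end SOEnv

/-- The value of a term. -/
def SOTerm.eval {L : FirstOrder.Language.{uF, uR}} {A : Type uA} [L.Structure A] (e : SOEnv A) :
    SOTerm L → A
  | .var x => e.ind x
  | .func f t => FirstOrder.Language.Structure.funMap f fun i => (t i).eval e
  | .app n F t => e.func n F fun i => (t i).eval e

/-- Satisfaction in second-order logic with the standard (full) semantics. -/
def SOFormula.Sat {L : FirstOrder.Language.{uF, uR}} {A : Type uA} [L.Structure A] :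
    SOFormula L → SOEnv A → Prop
  | .bot, _ => False
  | .eq t u, e => t.eval e = u.eval e
  | .rel r t, e => FirstOrder.Language.Structure.RelMap r fun i => (t i).eval e
  | .relVar n R t, e => (fun i => (t i).eval e) ∈ e.rel n R
  | .neg φ, e => ¬ φ.Sat e
  | .and φ ψ, e => φ.Sat e ∧ ψ.Sat e
  | .or φ ψ, e => φ.Sat e ∨ ψ.Sat e
  | .ex x φ, e => ∃ a : A, φ.Sat (e.setInd x a)
  | .all x φ, e => ∀ a : A, φ.Sat (e.setInd x a)
  | .exFun n F φ, e => ∃ f : (Fin n → A) → A, φ.Sat (e.setFunc n F f)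
  | .allFun n F φ, e => ∀ f : (Fin n → A) → A, φ.Sat (e.setFunc n F f)
  | .exRel n R φ, e => ∃ r : Set (Fin n → A), φ.Sat (e.setRel n R r)
  | .allRel n R φ, e => ∀ r : Set (Fin n → A), φ.Sat (e.setRel n R r)

/-- Truth of a second-order sentence in the structure `S` on the domain `A`. As a sentence has no
free variables, the environment is immaterial. -/
def SOSentence.TrueIn {L : FirstOrder.Language.{uF, uR}} {A : Type uA} (S : L.Structure A)
    (Φ : SOSentence L) : Prop :=
  ∀ e : SOEnv A, Φ.1.Sat e

/-! ### Relational encoding of hyperteams -/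

/-- The relation symbols of the signature with a single relation symbol, of arity `k`. -/
inductive FreshRel (k : ℕ) : ℕ → Type
  | R : FreshRel k k

/-- The signature with a single relation symbol, of arity `k`. -/
def freshLanguage (k : ℕ) : FirstOrder.Language.{0, 0} where
  Functions := fun _ => Empty
  Relations := FreshRel k

/-- The interpretation of the symbols of `freshLanguage k` by a relation `T`. -/
def freshRelMap {A : Type uA} {k : ℕ} (T : Set (Fin k → A)) :
    {n : ℕ} → FreshRel k n → (Fin n → A) → Prop
  | _, .R => fun v => v ∈ T

/-- The relation `T` as a structure for the signature with one relation symbol. -/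
abbrev freshStructure {A : Type uA} {k : ℕ} (T : Set (Fin k → A)) :
    (freshLanguage k).Structure A where
  funMap := fun f => Empty.elim f
  RelMap := fun r => freshRelMap T r

/-- The expansion of an `L`-structure by the interpretation `T` of a fresh `k`-ary relation
symbol. -/
abbrev expansion (L : FirstOrder.Language.{uF, uR}) {A : Type uA} [L.Structure A] {k : ℕ}
    (T : Set (Fin k → A)) : (L.sum (freshLanguage k)).Structure A :=
  letI := freshStructure T
  inferInstance

/-- The element `a` codes the team `X` over the variables enumerated by `x`: an assignment over
these variables is in `X` iff the tuple of its values, followed by `a`, is in `T`. -/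
def CodesTeam {Var : Type uV} {A : Type uA} {n : ℕ} (x : Fin n → Var)
    (T : Set (Fin (n + 1) → A)) (a : A) (X : Team Var A) : Prop :=
  ∀ s : Asg Var A, s.dom = Set.range x →
    (s ∈ X ↔ ∃ v : Fin n → A,
      (∀ i, s (x i) = some (v i)) ∧ (Fin.snoc v a : Fin (n + 1) → A) ∈ T)

/-- `T` is a relational encoding of the hyperteam `H` over the variables enumerated by `x`: every
team of `H` is coded by an element, every element codes a team of `H`, and the empty hyperteam,
in which no team can be coded, is encoded by the empty relation. -/
structure IsRelationalEncoding {Var : Type uV} {A : Type uA} {n : ℕ} (x : Fin n → Var)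
    (H : Hyperteam Var A) (T : Set (Fin (n + 1) → A)) : Prop where
  team_coded : ∀ X ∈ H, ∃ a : A, CodesTeam x T a X
  codes_team : H.Nonempty → ∀ a : A, ∃ X ∈ H, CodesTeam x T a X
  empty_code : H = ∅ → T = ∅

end ADFLogic

open ADFLogic

namespace ADFLogic

/-! ### Alternating satisfaction of properties of assignments -/

section Flat

variable {Var : Type uV} {A : Type uA}

/-! On a quantifier-free matrix, satisfaction is flat: it only asks whether some team consists of
assignments with a given property, or whether every team contains one (`sat_iff_holds`). Dualizing a
hyperteam merely exchanges these two readings, because a choice function on the teams is exactly a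
witness for the second (`holds_ea_dual`, `holds_ae_dual`). Extending a hyperteam by all `W`-uniform
functions amounts to one quantifier over such functions, placed in front of the flat condition. The
hyperteam can therefore stay fixed while the prefix becomes a chain of function quantifiers. The
order is reversed: the outermost ADF quantifier acts on the hyperteam first, so its function is
chosen last (`sat_prenex_iff`). What remains is to say this in second-order logic. On assignments
with a fixed finite domain, a uniform function is a function of finitely many values
(`exists_liftTuple_eq`), so each quantifier becomes one over a function variable of finite arity
(`sat_addPrefix`). Composing these functions yields nested Skolem terms, which are substituted into
the matrix (`transform_evalAsg`, `sat_toSO`). Quantification over teams becomes quantification over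
codes in the relational encoding (`holds_ea_iff_of_encoding`). A universal closure finally turns the
formula into a sentence (`trueIn_closure_iff`). -/

/-- The hyperteam `H` satisfies the property `M` of assignments with respect to a flag. -/
def Holds : AltFlag → Hyperteam Var A → (Asg Var A → Prop) → Prop
  | .ea, H, M => ∃ X ∈ H, ∀ s ∈ X, M s
  | .ae, H, M => ∀ X ∈ H, ∃ s ∈ X, M s

theorem not_holds_dual (α : AltFlag) (H : Hyperteam Var A) (M : Asg Var A → Prop) :
    ¬ Holds α.dual H M ↔ Holds α H fun s => ¬ M s := by
  cases α <;> simp [Holds, AltFlag.dual]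

/-- A team of the dual is the image of a choice function; it lies inside `M` precisely when the
function picks a witness of `M` in every team. -/
theorem holds_ea_dual (H : Hyperteam Var A) (M : Asg Var A → Prop) :
    Holds .ea H.dual M ↔ Holds .ae H M := by
  constructor
  · rintro ⟨_, ⟨c, hc, rfl⟩, hM⟩ X hX
    exact ⟨c ⟨X, hX⟩, hc ⟨X, hX⟩, hM _ ⟨_, rfl⟩⟩
  · intro h
    choose c hc hM using h
    refine ⟨_, ⟨fun X => c X.1 X.2, fun X => hc X.1 X.2, rfl⟩, ?_⟩
    rintro _ ⟨X, rfl⟩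
    exact hM X.1 X.2

theorem holds_ae_dual (H : Hyperteam Var A) (M : Asg Var A → Prop) :
    Holds .ae H.dual M ↔ Holds .ea H M := by
  have h := not_congr (holds_ea_dual H fun s => ¬ M s)
  have h₁ := not_holds_dual .ae H.dual fun s => ¬ M s
  have h₂ := not_holds_dual .ea H fun s => ¬ M s
  simp only [AltFlag.dual, not_not] at h₁ h₂
  exact h₁.symm.trans (h.trans h₂)

theorem holds_ea_ext (H : Hyperteam Var A) (W : Set Var) (x : Var) (M : Asg Var A → Prop) :
    Holds .ea (H.ext W x) M ↔
      ∃ F : Asg Var A → A, Uniform W F ∧ Holds .ea H fun s => M (s.update x (F s)) := by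
  constructor
  · rintro ⟨_, ⟨X, hX, F, hF, rfl⟩, hM⟩
    exact ⟨F, hF, X, hX, fun s hs => hM _ ⟨s, hs, rfl⟩⟩
  · rintro ⟨F, hF, X, hX, hM⟩
    refine ⟨_, ⟨X, hX, F, hF, rfl⟩, ?_⟩
    rintro _ ⟨s, hs, rfl⟩
    exact hM s hs

theorem holds_ae_ext (H : Hyperteam Var A) (W : Set Var) (x : Var) (M : Asg Var A → Prop) :
    Holds .ae (H.ext W x) M ↔
      ∀ F : Asg Var A → A, Uniform W F → Holds .ae H fun s => M (s.update x (F s)) := by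
  constructor
  · intro h F hF X hX
    obtain ⟨_, ⟨s, hs, rfl⟩, hM⟩ := h _ ⟨X, hX, F, hF, rfl⟩
    exact ⟨s, hs, hM⟩
  · rintro h _ ⟨X, hX, F, hF, rfl⟩
    obtain ⟨s, hs, hM⟩ := h F hF X hX
    exact ⟨_, ⟨s, hs, rfl⟩, hM⟩

/-- The worst partition puts into the first part exactly the teams that leave `M`. Then only the
second part can succeed, and a team that succeeds there satisfies both properties. -/
theorem forall_bipartition_iff (H : Hyperteam Var A) (M N : Asg Var A → Prop) :
    (∀ H₁ H₂, IsBipartition H H₁ H₂ → Holds .ea H₁ M ∨ Holds .ea H₂ N) ↔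
      Holds .ea H fun s => M s ∧ N s := by
  constructor
  · intro h
    rcases h {X ∈ H | ¬ ∀ s ∈ X, M s} {X ∈ H | ∀ s ∈ X, M s} ⟨by ext X; simp; tauto,
      by ext X; simp only [Set.mem_union, Set.mem_ofPred_eq]; tauto⟩ with ⟨X, hX, hM⟩ | ⟨X, hX, hN⟩
    · exact absurd hM hX.2
    · exact ⟨X, hX.1, fun s hs => ⟨hX.2 s hs, hN s hs⟩⟩
  · rintro ⟨X, hX, hMN⟩ H₁ H₂ ⟨-, rfl⟩
    exact hX.imp (fun h => ⟨X, h, fun s hs => (hMN s hs).1⟩)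
      fun h => ⟨X, h, fun s hs => (hMN s hs).2⟩

theorem exists_bipartition_iff (H : Hyperteam Var A) (M N : Asg Var A → Prop) :
    (∃ H₁ H₂, IsBipartition H H₁ H₂ ∧ Holds .ae H₁ M ∧ Holds .ae H₂ N) ↔
      Holds .ae H fun s => M s ∨ N s := by
  constructor
  · rintro ⟨H₁, H₂, ⟨-, rfl⟩, hM, hN⟩ X hX
    rcases hX with hX | hX
    · obtain ⟨s, hs, h⟩ := hM X hX
      exact ⟨s, hs, .inl h⟩
    · obtain ⟨s, hs, h⟩ := hN X hX
      exact ⟨s, hs, .inr h⟩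
  · intro h
    refine ⟨{X ∈ H | ∃ s ∈ X, M s}, {X ∈ H | ¬ ∃ s ∈ X, M s}, ⟨?_, ?_⟩, fun X hX => hX.2, ?_⟩
    · ext X; simp; tauto
    · ext X
      simp only [Set.mem_union, Set.mem_ofPred_eq, ← and_or_left]
      exact and_iff_left (em _)
    · rintro X ⟨hX, hM⟩
      obtain ⟨s, hs, h | h⟩ := h X hX
      · exact absurd ⟨s, hs, h⟩ hM
      · exact ⟨s, hs, h⟩

/-- The truth of a quantifier-free formula under a single assignment. -/
def ADFFormula.SatAt {L : FirstOrder.Language.{uF, uR}} [L.Structure A] :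
    ADFFormula L Var → Asg Var A → Prop
  | .bot, _ => False
  | .top, _ => True
  | .eq x y, s => ∃ a : A, s x = some a ∧ s y = some a
  | .rel (n := n) r x, s => ∃ v : Fin n → A,
      (∀ i, s (x i) = some (v i)) ∧ FirstOrder.Language.Structure.RelMap r v
  | .neg φ, s => ¬ φ.SatAt s
  | .and φ ψ, s => φ.SatAt s ∧ ψ.SatAt s
  | .or φ ψ, s => φ.SatAt s ∨ ψ.SatAt s
  | .quant _ _ _ _, _ => False

theorem sat_iff_holds {L : FirstOrder.Language.{uF, uR}} [L.Structure A] (ψ : ADFFormula L Var)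
    (hψ : ψ.IsQuantifierFree) (α : AltFlag) (H : Hyperteam Var A) :
    Sat ψ α H ↔ Holds α H ψ.SatAt := by
  induction ψ generalizing α H with
  | bot =>
    cases α
    · simp [Sat, Holds, ADFFormula.SatAt, ← Set.eq_empty_iff_forall_notMem]
    · simp [Sat, Holds, ADFFormula.SatAt, Set.eq_empty_iff_forall_notMem]
  | top =>
    cases α
    · simp [Sat, Holds, ADFFormula.SatAt, ← Set.nonempty_iff_ne_empty, Set.Nonempty]
    · simp only [Sat, Holds, ADFFormula.SatAt, and_true]
      exact ⟨fun h X hX => Set.nonempty_iff_ne_empty.2 (by rintro rfl; exact h hX),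
        fun h h' => by simpa using h ∅ h'⟩
  | eq x y => cases α <;> simp only [Sat, Holds, ADFFormula.SatAt]
  | rel r x => cases α <;> simp only [Sat, Holds, ADFFormula.SatAt]
  | neg φ ih =>
    rw [Sat, ih hψ, not_holds_dual]
    rfl
  | and φ₁ φ₂ ih₁ ih₂ =>
    have h : ∀ H : Hyperteam Var A, (∀ H₁ H₂, IsBipartition H H₁ H₂ →
        Sat φ₁ .ea H₁ ∨ Sat φ₂ .ea H₂) ↔ Holds .ea H (ADFFormula.and φ₁ φ₂).SatAt := fun H => by
      simp only [ih₁ hψ.1, ih₂ hψ.2]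
      exact forall_bipartition_iff H _ _
    cases α
    · rw [Sat, h]
    · rw [Sat, h, holds_ea_dual]
  | or φ₁ φ₂ ih₁ ih₂ =>
    have h : ∀ H : Hyperteam Var A, (∃ H₁ H₂, IsBipartition H H₁ H₂ ∧
        Sat φ₁ .ae H₁ ∧ Sat φ₂ .ae H₂) ↔ Holds .ae H (ADFFormula.or φ₁ φ₂).SatAt := fun H => by
      simp only [ih₁ hψ.1, ih₂ hψ.2]
      exact exists_bipartition_iff H _ _
    cases α
    · rw [Sat, h, holds_ae_dual]
    · rw [Sat, h]
  | quant => exact hψ.elim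

/-- Quantification over the `W`-uniform functions. -/
def QuantUniform (W : Set Var) : Quant → ((Asg Var A → A) → Prop) → Prop
  | .exist, P => ∃ F, Uniform W F ∧ P F
  | .univ, P => ∀ F, Uniform W F → P F

/-- The prefix `p` as a sequence of quantifiers over uniform functions, in reversed order, applied
to a property of the transformation of assignments that the functions determine. -/
noncomputable def ReversedPrefix :
    List (QuantEntry Var) → ((Asg Var A → Asg Var A) → Prop) → Prop
  | [], B => B id
  | e :: p, B => ReversedPrefix p fun g =>
      QuantUniform (e.W : Set Var) e.q fun F => B fun s => g (s.update e.x (F s))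

/-- The induction hypothesis is applied to the hyperteam already extended by the first quantifier,
so the function of that quantifier appears inside those of the remaining prefix. Wherever the flag
does not match the quantifier, the dual in the semantics is absorbed by the flag change in `Holds`.
-/
theorem sat_prenex_iff {L : FirstOrder.Language.{uF, uR}} [L.Structure A]
    (p : List (QuantEntry Var)) (ψ : ADFFormula L Var) (hψ : ψ.IsQuantifierFree) (α : AltFlag)
    (H : Hyperteam Var A) :
    Sat (prenex p ψ) α H ↔ ReversedPrefix p fun g => Holds α H fun s => ψ.SatAt (g s) := by
  induction p generalizing α H with
  | nil => exact sat_iff_holds ψ hψ α H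
  | cons e p ih =>
    obtain ⟨q, W, x⟩ := e
    cases q <;> cases α <;>
      simp only [prenex, Sat, ReversedPrefix, QuantUniform, ih, holds_ea_ext, holds_ae_ext,
        holds_ea_dual, holds_ae_dual]

theorem dom_update (s : Asg Var A) (x : Var) (a : A) :
    (s.update x a).dom = insert x s.dom := by
  classical
  ext y
  by_cases h : y = x <;> simp [Asg.dom, Asg.update, Function.update_apply, h]

end Flat

/-! ### Functions on assignments as functions on tuples -/

section Tuples

variable {Var : Type uV} {A : Type uA}

open Classical in
/-- The variables in `W` that have a value in an assignment with the domain `D`. -/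
noncomputable def relevant (W : Finset Var) (D : Set Var) : Finset Var := W.filter (· ∈ D)

/-- The enumeration of the relevant variables. -/
noncomputable def enumRelevant (W : Finset Var) (D : Set Var) (j : Fin (relevant W D).card) :
    Var :=
  (relevant W D).equivFin.symm j

theorem enumRelevant_mem (W : Finset Var) (D : Set Var) (j : Fin (relevant W D).card) :
    enumRelevant W D j ∈ W ∧ enumRelevant W D j ∈ D := by
  classical
  exact Finset.mem_filter.1 ((relevant W D).equivFin.symm j).2

theorem exists_enumRelevant {W : Finset Var} {D : Set Var} {y : Var} (hW : y ∈ W) (hD : y ∈ D) :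
    ∃ j, enumRelevant W D j = y := by
  classical
  refine ⟨(relevant W D).equivFin ⟨y, Finset.mem_filter.2 ⟨hW, hD⟩⟩, ?_⟩
  rw [enumRelevant, Equiv.symm_apply_apply]

variable [Nonempty A]

/-- The function on assignments given by a function on the values of the relevant variables. -/
noncomputable def liftTuple (W : Finset Var) (D : Set Var)
    (f : (Fin (relevant W D).card → A) → A) (s : Asg Var A) : A :=
  f fun j => (s (enumRelevant W D j)).getD (Classical.arbitrary A)

theorem uniform_liftTuple (W : Finset Var) (D : Set Var)
    (f : (Fin (relevant W D).card → A) → A) : Uniform (W : Set Var) (liftTuple W D f) := by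
  intro s
  simp [liftTuple, Asg.restrict, (enumRelevant_mem W D _).1]

theorem exists_liftTuple_eq {W : Finset Var} {F : Asg Var A → A} (hF : Uniform (W : Set Var) F)
    (D : Set Var) : ∃ f, ∀ s : Asg Var A, s.dom = D → F s = liftTuple W D f s := by
  classical
  -- The tuple is turned back into the assignment restricted to `W ∩ D` and fed to `F`; by
  -- uniformity this is all that `F` sees of an assignment with domain `D`.
  refine ⟨fun v => F fun y => if h : ∃ j, enumRelevant W D j = y then some (v h.choose) else none,
    fun s hs => ?_⟩
  rw [hF s, liftTuple]
  congr 1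
  funext y
  split_ifs with h
  · beta_reduce
    rw [h.choose_spec]
    have hy := enumRelevant_mem W D h.choose
    rw [h.choose_spec, ← hs] at hy
    obtain ⟨a, ha⟩ := Option.ne_none_iff_exists'.1 hy.2
    simp [Asg.restrict, hy.1, ha]
  · by_cases hW : y ∈ W
    · have hD : y ∉ D := fun hD => h (exists_enumRelevant hW hD)
      rw [← hs] at hD
      simpa [Asg.restrict, hW, Asg.dom] using hD
    · simp [Asg.restrict, hW]

end Tuples

/-! ### Translation into second-order logic -/

section Translation

variable {Var : Type uV} {A : Type uA} {L : FirstOrder.Language.{uF, uR}}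

/-- Quantification of a function variable. -/
def SOFormula.quantFun (m F : ℕ) : Quant → SOFormula L → SOFormula L
  | .exist, φ => .exFun m F φ
  | .univ, φ => .allFun m F φ

/-- Prefix `φ` with the reversed quantifiers of `p`, over function variables named from `i` on;
`D` is the domain of the assignments before the first quantifier of `p`. -/
noncomputable def SOFormula.addPrefix :
    List (QuantEntry Var) → ℕ → Set Var → SOFormula L → SOFormula L
  | [], _, _, φ => φ
  | e :: p, i, D, φ =>
      addPrefix p (i + 1) (insert e.x D) (.quantFun (relevant e.W D).card i e.q φ)

/-- The transformation of assignments determined by the function variables of the prefix `p`. -/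
noncomputable def SOEnv.transform [Nonempty A] (e : SOEnv A) :
    List (QuantEntry Var) → ℕ → Set Var → Asg Var A → Asg Var A
  | [], _, _, s => s
  | z :: p, i, D, s =>
      e.transform p (i + 1) (insert z.x D) (s.update z.x (liftTuple z.W D (e.func _ i) s))

theorem SOEnv.transform_setFunc [Nonempty A] (e : SOEnv A) (p : List (QuantEntry Var))
    {i j : ℕ} (hij : j < i) (D : Set Var) (m : ℕ) (f : (Fin m → A) → A) :
    (e.setFunc m j f).transform p i D = e.transform p i D := by
  induction p generalizing i D with
  | nil => rfl
  | cons z p ih =>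
    have h : ∀ k, (e.setFunc m j f).func k i = e.func k i := fun k => by
      by_cases hk : k = m
      · subst hk
        simp [SOEnv.setFunc, Function.update_of_ne hij.ne']
      · simp [SOEnv.setFunc, Function.update_of_ne hk]
    funext s
    simp only [SOEnv.transform, h, ih (Nat.lt_succ_of_lt hij)]

theorem SOEnv.transform_congr [Nonempty A] {e e' : SOEnv A} (h : e.func = e'.func)
    (p : List (QuantEntry Var)) (i : ℕ) (D : Set Var) :
    e.transform p i D = e'.transform p i D := by
  induction p generalizing i D with
  | nil => rfl
  | cons z p ih =>
    funext s
    simp only [SOEnv.transform, h, ih]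

/-- The condition `hB`, that `B` depends only on the values of a transformation on assignments with
domain `D`, is what allows arbitrary uniform functions to be replaced by functions on tuples. -/
theorem sat_addPrefix [Nonempty A] [L.Structure A] (p : List (QuantEntry Var)) (i : ℕ)
    (D : Set Var) (φ : SOFormula L) (B : (Asg Var A → Asg Var A) → Prop)
    (hB : ∀ g g' : Asg Var A → Asg Var A, (∀ s, s.dom = D → g s = g' s) → B g → B g')
    (hφ : ∀ e : SOEnv A, φ.Sat e ↔ B (e.transform p i D)) (e : SOEnv A) :
    (φ.addPrefix p i D).Sat e ↔ ReversedPrefix p B := by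
  induction p generalizing i D φ B with
  | nil => exact hφ e
  | cons z p ih =>
    obtain ⟨q, W, x⟩ := z
    refine ih (i + 1) (insert x D) _ _ ?_ ?_
    -- Invariance passes to the next stage because an update at `x` leads from domain `D` to `insert
    -- x D`.
    · have hg : ∀ g g' : Asg Var A → Asg Var A, (∀ s, s.dom = insert x D → g s = g' s) →
          ∀ F : Asg Var A → A, (B fun s => g (s.update x (F s))) →
            B fun s => g' (s.update x (F s)) := fun g g' h F =>
        hB _ _ fun s hs => h _ (by rw [dom_update, hs])
      intro g g' h
      cases q
      · exact fun ⟨F, hF, hF'⟩ => ⟨F, hF, hg g g' h F hF'⟩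
      · exact fun h' F hF => hg g g' h F (h' F hF)
    · intro e
      have key : ∀ f, φ.Sat (e.setFunc (relevant W D).card i f) ↔
          B fun s => e.transform p (i + 1) (insert x D) (s.update x (liftTuple W D f s)) := by
        intro f
        rw [hφ]
        simp only [SOEnv.transform]
        -- The rest of the prefix uses only names above `i`, so it does not notice the new value of
        -- function variable `i`.
        rw [SOEnv.transform_setFunc _ _ (Nat.lt_succ_self i)]
        simp [SOEnv.setFunc]
      cases q
      · simp only [SOFormula.quantFun, SOFormula.Sat, QuantUniform, key]
        constructor
        · rintro ⟨f, hf⟩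
          exact ⟨_, uniform_liftTuple W D f, hf⟩
        · rintro ⟨F, hF, h⟩
          obtain ⟨f, hf⟩ := exists_liftTuple_eq hF D
          exact ⟨f, hB _ _ (fun s hs => by rw [hf s hs]) h⟩
      · simp only [SOFormula.quantFun, SOFormula.Sat, QuantUniform, key]
        constructor
        · intro h F hF
          obtain ⟨f, hf⟩ := exists_liftTuple_eq hF D
          exact hB _ _ (fun s hs => by rw [hf s hs]) (h f)
        · exact fun h f => h _ (uniform_liftTuple W D f)

open Classical in
/-- The assignment with the domain `D` given by the values of the terms `σ`. -/
noncomputable def evalAsg [L.Structure A] (e : SOEnv A) (D : Set Var) (σ : Var → SOTerm L) :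
    Asg Var A :=
  fun y => if y ∈ D then some ((σ y).eval e) else none

open Classical in
/-- The terms for the values of all variables after the prefix `p`, with function variables named
from `i` on. -/
noncomputable def skolemTerms :
    List (QuantEntry Var) → ℕ → Set Var → (Var → SOTerm L) → Var → SOTerm L
  | [], _, _, σ => σ
  | z :: p, i, D, σ => skolemTerms p (i + 1) (insert z.x D)
      (Function.update σ z.x (.app _ i fun j => σ (enumRelevant z.W D j)))

/-- The domain after the prefix `p`. -/
def prefixDomain : List (QuantEntry Var) → Set Var → Set Var
  | [], D => D
  | z :: p, D => prefixDomain p (insert z.x D)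

theorem transform_evalAsg [Nonempty A] [L.Structure A] (e : SOEnv A) (p : List (QuantEntry Var))
    (i : ℕ) (D : Set Var) (σ : Var → SOTerm L) :
    e.transform p i D (evalAsg e D σ) = evalAsg e (prefixDomain p D) (skolemTerms p i D σ) := by
  classical
  induction p generalizing i D σ with
  | nil => rfl
  | cons z p ih =>
    rw [SOEnv.transform, skolemTerms, prefixDomain, ← ih]
    congr 1
    funext y
    by_cases h : y = z.x
    · subst h
      simp [evalAsg, Asg.update, liftTuple, SOTerm.eval, (enumRelevant_mem z.W D _).2]
    · simp [evalAsg, Asg.update, h]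

open Classical in
/-- The translation of a quantifier-free formula, with the terms `σ` for the variables in `D`. -/
noncomputable def ADFFormula.toSO {k : ℕ} (D : Set Var)
    (σ : Var → SOTerm (L.sum (freshLanguage k))) : ADFFormula L Var → SOFormula (L.sum (freshLanguage k))
  | .bot => .bot
  | .top => .neg .bot
  | .eq x y => if x ∈ D ∧ y ∈ D then .eq (σ x) (σ y) else .bot
  | .rel r x => if ∀ i, x i ∈ D then .rel (Sum.inl r) (fun i => σ (x i)) else .bot
  | .neg φ => .neg (φ.toSO D σ)
  | .and φ ψ => .and (φ.toSO D σ) (ψ.toSO D σ)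
  | .or φ ψ => .or (φ.toSO D σ) (ψ.toSO D σ)
  | .quant _ _ _ _ => .bot

/-- An atom with a variable outside `D` is translated to falsity, in agreement with `SatAt`, where
an atom with an undefined value fails. -/
theorem sat_toSO [L.Structure A] {k : ℕ} (T : Set (Fin k → A)) (D : Set Var)
    (σ : Var → SOTerm (L.sum (freshLanguage k))) (ψ : ADFFormula L Var) (e : SOEnv A) :
    letI := expansion L T
    (ψ.toSO D σ).Sat e ↔ ψ.SatAt (evalAsg e D σ) := by
  let := expansion L T
  change (ψ.toSO D σ).Sat e ↔ ψ.SatAt (evalAsg e D σ)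
  induction ψ with
  | bot => exact Iff.rfl
  | top => exact iff_of_true id trivial
  | eq x y =>
    simp only [ADFFormula.toSO, ADFFormula.SatAt, evalAsg]
    by_cases h : x ∈ D ∧ y ∈ D
    · simp [SOFormula.Sat, h.1, h.2, eq_comm]
    · rw [if_neg h]
      refine iff_of_false id ?_
      rintro ⟨a, hx, hy⟩
      refine h ⟨?_, ?_⟩ <;> by_contra hD <;> simp [hD] at hx hy
  | rel r x =>
    simp only [ADFFormula.toSO, ADFFormula.SatAt, evalAsg]
    split_ifs with h
    · simp only [SOFormula.Sat, h, if_true, Option.some.injEq]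
      exact ⟨fun hr => ⟨_, fun _ => rfl, hr⟩, fun ⟨v, hv, hr⟩ => by
        obtain rfl : (fun i => (σ (x i)).eval e) = v := funext hv
        exact hr⟩
    · refine iff_of_false id ?_
      rintro ⟨v, hv, -⟩
      refine h fun i => ?_
      by_contra hD
      simpa [hD] using hv i
  | neg φ ih => exact not_congr ih
  | and φ₁ φ₂ ih₁ ih₂ => exact and_congr ih₁ ih₂
  | or φ₁ φ₂ ih₁ ih₂ => exact or_congr ih₁ ih₂
  | quant => exact Iff.rfl

/-- Existential quantification of the first `k` individual variables. -/
def SOFormula.exBlock : ℕ → SOFormula L → SOFormula L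
  | 0, φ => φ
  | k + 1, φ => exBlock k (.ex k φ)

/-- Change the values of the first `k` individual variables. -/
def SOEnv.setTuple (e : SOEnv A) {k : ℕ} (v : Fin k → A) : SOEnv A :=
  { e with ind := fun j => if h : j < k then v ⟨j, h⟩ else e.ind j }

theorem SOEnv.setTuple_snoc (e : SOEnv A) {k : ℕ} (v : Fin k → A) (a : A) :
    (e.setTuple v).setInd k a = e.setTuple (Fin.snoc v a : Fin (k + 1) → A) := by
  simp only [SOEnv.setTuple, SOEnv.setInd, SOEnv.mk.injEq, and_true]
  funext j
  rcases lt_trichotomy j k with h | rfl | h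
  · simp [Function.update_of_ne h.ne, h, Nat.lt_succ_of_lt h, Fin.snoc]
  · simp [Fin.snoc]
  · simp [Function.update_of_ne h.ne', h.not_gt, (Nat.succ_le_of_lt h).not_gt]

theorem sat_exBlock [L.Structure A] (k : ℕ) (φ : SOFormula L) (e : SOEnv A) :
    (φ.exBlock k).Sat e ↔ ∃ v : Fin k → A, φ.Sat (e.setTuple v) := by
  induction k generalizing φ with
  | zero =>
    have h : ∀ v : Fin 0 → A, e.setTuple v = e := fun v => by simp [SOEnv.setTuple]
    simp [SOFormula.exBlock, h]
  | succ k ih =>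
    simp only [SOFormula.exBlock, ih, SOFormula.Sat, SOEnv.setTuple_snoc]
    constructor
    · rintro ⟨v, a, h⟩
      exact ⟨_, h⟩
    · rintro ⟨v, h⟩
      exact ⟨Fin.init v, v (Fin.last k), by rwa [Fin.snoc_init_self]⟩

end Translation

/-! ### Universal closure -/

section Closure

variable {L : FirstOrder.Language.{uF, uR}}

/-- Universal quantification of a variable of any sort. -/
def SOVar.all : SOVar → SOFormula L → SOFormula L
  | .ind x, φ => .all x φ
  | .func n F, φ => .allFun n F φ
  | .rel n R, φ => .allRel n R φ

theorem SOTerm.finite_vars (t : SOTerm L) : t.vars.Finite := by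
  induction t with
  | var x => exact Set.finite_singleton _
  | func f t ih => exact Set.finite_iUnion ih
  | app n F t ih => exact (Set.finite_singleton _).union (Set.finite_iUnion ih)

theorem SOFormula.finite_freeVars (φ : SOFormula L) : φ.freeVars.Finite := by
  induction φ with
  | bot => exact Set.finite_empty
  | eq t u => exact t.finite_vars.union u.finite_vars
  | rel r t => exact Set.finite_iUnion fun i => (t i).finite_vars
  | relVar n R t =>
    exact (Set.finite_singleton _).union (Set.finite_iUnion fun i => (t i).finite_vars)
  | neg φ ih => exact ih
  | and φ ψ ih₁ ih₂ => exact ih₁.union ih₂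
  | or φ ψ ih₁ ih₂ => exact ih₁.union ih₂
  | ex x φ ih => exact ih.sdiff
  | all x φ ih => exact ih.sdiff
  | exFun n F φ ih => exact ih.sdiff
  | allFun n F φ ih => exact ih.sdiff
  | exRel n R φ ih => exact ih.sdiff
  | allRel n R φ ih => exact ih.sdiff

theorem freeVars_foldr_all (l : List SOVar) (φ : SOFormula L) :
    (l.foldr SOVar.all φ).freeVars = φ.freeVars \ {v | v ∈ l} := by
  induction l with
  | nil => simp
  | cons v l ih =>
    have h : (v.all (l.foldr SOVar.all φ)).freeVars = (l.foldr SOVar.all φ).freeVars \ {v} := by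
      cases v <;> rfl
    rw [List.foldr_cons, h, ih]
    ext w
    simp
    tauto

/-- The universal closure of a formula of second-order logic. -/
noncomputable def SOFormula.closure (φ : SOFormula L) : SOSentence L :=
  ⟨φ.finite_freeVars.toFinset.toList.foldr SOVar.all φ, by
    rw [freeVars_foldr_all]
    ext v
    simp⟩

/-- A formula whose truth does not depend on the environment keeps its truth value under universal
quantifiers over non-empty ranges, so its free variables need not be computed. -/
theorem trueIn_closure_iff {A : Type uA} [Nonempty A] (S : L.Structure A) (φ : SOFormula L)
    (C : Prop) (h : ∀ e : SOEnv A, φ.Sat e ↔ C) : φ.closure.TrueIn S ↔ C := by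
  have key : ∀ (l : List SOVar) (e : SOEnv A), (l.foldr SOVar.all φ).Sat e ↔ C := by
    intro l
    induction l with
    | nil => exact h
    | cons v l ih =>
      intro e
      cases v
      · exact (forall_congr' fun _ => ih _).trans (forall_const _)
      · exact (forall_congr' fun _ => ih _).trans (forall_const _)
      · exact (forall_congr' fun _ => ih _).trans (forall_const _)
  have : Nonempty (SOEnv A) :=
    ‹Nonempty A›.elim fun a => ⟨⟨fun _ => a, fun _ _ _ => a, fun _ _ => ∅⟩⟩
  exact (forall_congr' fun e => key _ e).trans (forall_const _)

end Closure

/-! ### Relational encodings -/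

section Encoding

variable {Var : Type uV} {A : Type uA} {n : ℕ} {x : Fin n → Var}

open Classical in
/-- The assignment of the values `v` to the variables `x`. -/
noncomputable def ofTuple (x : Fin n → Var) (v : Fin n → A) : Asg Var A :=
  fun y => if h : ∃ i, x i = y then some (v h.choose) else none

theorem ofTuple_apply (hx : Function.Injective x) (v : Fin n → A) (i : Fin n) :
    ofTuple x v (x i) = some (v i) := by
  have h : ∃ j, x j = x i := ⟨i, rfl⟩
  rw [ofTuple, dif_pos h, hx h.choose_spec]

theorem dom_ofTuple (x : Fin n → Var) (v : Fin n → A) : (ofTuple x v).dom = Set.range x := by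
  ext y
  simp [Asg.dom, ofTuple]

theorem eq_ofTuple (hx : Function.Injective x) {s : Asg Var A} (hs : s.dom = Set.range x)
    {v : Fin n → A} (hv : ∀ i, s (x i) = some (v i)) : s = ofTuple x v := by
  funext y
  by_cases h : ∃ i, x i = y
  · obtain ⟨i, rfl⟩ := h
    rw [hv, ofTuple_apply hx]
  · rw [ofTuple, dif_neg h]
    by_contra hy
    have hy : y ∈ s.dom := hy
    rw [hs] at hy
    exact h hy

theorem exists_eq_ofTuple (hx : Function.Injective x) {s : Asg Var A}
    (hs : s.dom = Set.range x) : ∃ v, s = ofTuple x v := by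
  have h : ∀ i, ∃ a, s (x i) = some a := fun i => by
    have hi : x i ∈ s.dom := by rw [hs]; exact ⟨i, rfl⟩
    exact Option.ne_none_iff_exists'.1 hi
  choose v hv using h
  exact ⟨v, eq_ofTuple hx hs hv⟩

theorem codesTeam_iff (hx : Function.Injective x) (T : Set (Fin (n + 1) → A)) (a : A)
    (X : Team Var A) :
    CodesTeam x T a X ↔
      ∀ v : Fin n → A, ofTuple x v ∈ X ↔ (Fin.snoc v a : Fin (n + 1) → A) ∈ T := by
  constructor
  · intro h v
    rw [h _ (dom_ofTuple x v)]
    constructor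
    · rintro ⟨w, hw, hT⟩
      obtain rfl : v = w := funext fun i => by simpa [ofTuple_apply hx] using hw i
      exact hT
    · exact fun hT => ⟨v, ofTuple_apply hx v, hT⟩
  · intro h s hs
    constructor
    · intro hX
      obtain ⟨v, rfl⟩ := exists_eq_ofTuple hx hs
      exact ⟨v, ofTuple_apply hx v, (h v).1 hX⟩
    · rintro ⟨v, hv, hT⟩
      rw [eq_ofTuple hx hs hv]
      exact (h v).2 hT

theorem exists_isRelationalEncoding (hx : Function.Injective x) (H : Hyperteam Var A)
    (hcard : Cardinal.mk H ≤ Cardinal.lift.{uV} (Cardinal.mk A)) :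
    ∃ T : Set (Fin (n + 1) → A), IsRelationalEncoding x H T := by
  rcases H.eq_empty_or_nonempty with rfl | hne
  · exact ⟨∅, by simp, by simp, fun _ => rfl⟩
  have : Nonempty H := hne.to_subtype
  rw [← Cardinal.mk_uLift, Cardinal.le_def] at hcard
  obtain ⟨f⟩ := hcard
  have hf : Function.Injective fun X : H => (f X).down :=
    ULift.down_injective.comp f.injective
  -- A left inverse of the injection into `A` lets every element code some team, while each team is
  -- coded by its own image.
  let g : A → H := Function.invFun fun X : H => (f X).down
  have hg : ∀ a, CodesTeam x {w : Fin (n + 1) → A | ofTuple x (Fin.init w) ∈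
      (g (w (Fin.last n)) : Team Var A)} a (g a : Team Var A) := fun a => by
    rw [codesTeam_iff hx]
    simp
  refine ⟨_, ⟨fun X hX => ⟨(f ⟨X, hX⟩).down, ?_⟩, fun _ a => ⟨_, (g a).2, hg a⟩,
    fun h => absurd h hne.ne_empty⟩⟩
  have h := hg (f ⟨X, hX⟩).down
  have h' : g (f ⟨X, hX⟩).down = ⟨X, hX⟩ := Function.leftInverse_invFun hf ⟨X, hX⟩
  rwa [h'] at h

/-- The demand that the code `a` occurs in `T` excludes the empty hyperteam, for which the universal
condition would hold vacuously. It costs nothing otherwise, since no team is empty. -/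
theorem holds_ea_iff_of_encoding (hx : Function.Injective x) {H : Hyperteam Var A}
    (hH : H.Over (Set.range x)) (hnull : ∅ ∉ H) {T : Set (Fin (n + 1) → A)}
    (hT : IsRelationalEncoding x H T) (M : Asg Var A → Prop) :
    Holds .ea H M ↔ ∃ a : A, (∃ v : Fin n → A, (Fin.snoc v a : Fin (n + 1) → A) ∈ T) ∧
      ∀ v : Fin n → A, (Fin.snoc v a : Fin (n + 1) → A) ∈ T → M (ofTuple x v) := by
  constructor
  · rintro ⟨X, hX, hM⟩
    obtain ⟨a, ha⟩ := hT.team_coded X hX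
    rw [codesTeam_iff hx] at ha
    have hne : X.Nonempty := Set.nonempty_iff_ne_empty.2 (by rintro rfl; exact hnull hX)
    obtain ⟨s, hs⟩ := hne
    obtain ⟨v, rfl⟩ := exists_eq_ofTuple hx (hH X hX s hs)
    exact ⟨a, ⟨v, (ha v).1 hs⟩, fun w hw => hM _ ((ha w).2 hw)⟩
  · rintro ⟨a, ⟨v, hv⟩, hM⟩
    have hne : H.Nonempty := Set.nonempty_iff_ne_empty.2 fun h => by
      rw [hT.empty_code h] at hv
      exact hv
    obtain ⟨X, hX, ha⟩ := hT.codes_team hne a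
    rw [codesTeam_iff hx] at ha
    refine ⟨X, hX, fun s hs => ?_⟩
    obtain ⟨w, rfl⟩ := exists_eq_ofTuple hx (hH X hX s hs)
    exact hM w ((ha w).1 hs)

end Encoding

/-! ### The sentences -/

section Sentences

variable {Var : Type uV} {A : Type uA} {L : FirstOrder.Language.{uF, uR}} {n : ℕ}

/-- The atom that applies the fresh relation symbol to the first `n + 1` individual variables. -/
def freshAtom (L : FirstOrder.Language.{uF, uR}) (n : ℕ) :
    SOFormula (L.sum (freshLanguage (n + 1))) :=
  .rel (n := n + 1) (Sum.inr (FreshRel.R : FreshRel (n + 1) (n + 1))) fun i => .var i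

/-- Some coded team has only assignments that falsify `φ`. -/
def someTeamAvoids (φ : SOFormula (L.sum (freshLanguage (n + 1)))) :
    SOFormula (L.sum (freshLanguage (n + 1))) :=
  .ex n (.and ((freshAtom L n).exBlock n) (.neg (((freshAtom L n).and φ).exBlock n)))

/-- The second-order version of `Holds`. -/
def holdsFormula (φ : SOFormula (L.sum (freshLanguage (n + 1)))) :
    AltFlag → SOFormula (L.sum (freshLanguage (n + 1)))
  | .ea => someTeamAvoids (.neg φ)
  | .ae => .neg (someTeamAvoids φ)

open Classical in
/-- The terms for the variables enumerated by `x`. -/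
noncomputable def initialTerms (L : FirstOrder.Language.{uF, uR}) (x : Fin n → Var) (y : Var) :
    SOTerm (L.sum (freshLanguage (n + 1))) :=
  .var (if h : ∃ i, x i = y then h.choose else 0)

theorem sat_holdsFormula [L.Structure A] {x : Fin n → Var}
    (hx : Function.Injective x) {H : Hyperteam Var A} (hH : H.Over (Set.range x)) (hnull : ∅ ∉ H)
    {T : Set (Fin (n + 1) → A)} (hT : IsRelationalEncoding x H T)
    (φ : SOFormula (L.sum (freshLanguage (n + 1)))) (M : Asg Var A → Prop) (e : SOEnv A)
    (hφ : letI := expansion L T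
      ∀ a (v : Fin n → A), φ.Sat ((e.setInd n a).setTuple v) ↔ M (ofTuple x v)) (α : AltFlag) :
    letI := expansion L T
    (holdsFormula φ α).Sat e ↔ Holds α H M := by
  let := expansion L T
  have hR : ∀ a (v : Fin n → A), (freshAtom L n).Sat ((e.setInd n a).setTuple v) ↔
      (Fin.snoc v a : Fin (n + 1) → A) ∈ T := fun a v => by
    -- Variable `n` holds the code and the variables below `n` hold the tuple, so `setTuple` leaves
    -- the code in place.
    have h : (fun i : Fin (n + 1) => ((e.setInd n a).setTuple v).ind i) = Fin.snoc v a := by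
      funext i
      refine Fin.lastCases ?_ (fun j => ?_) i <;> simp [SOEnv.setTuple, SOEnv.setInd]
    rw [← h]
    exact Iff.rfl
  -- Both flags reduce to this: `ea` by taking the negation of `φ` for `χ`, and `ae` by negating the
  -- instance for `φ`.
  have key : ∀ (χ : SOFormula (L.sum (freshLanguage (n + 1)))) (N : Asg Var A → Prop),
      (∀ a (v : Fin n → A), χ.Sat ((e.setInd n a).setTuple v) ↔ N (ofTuple x v)) →
      ((someTeamAvoids χ).Sat e ↔ Holds .ea H fun s => ¬ N s) := fun χ N hχ => by
    rw [holds_ea_iff_of_encoding hx hH hnull hT]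
    simp only [someTeamAvoids, SOFormula.Sat, sat_exBlock, hR, hχ, not_exists, not_and]
  cases α
  · refine (key (.neg φ) (fun s => ¬ M s) fun a v => not_congr (hφ a v)).trans ?_
    simp only [not_not]
  · refine (not_congr (key φ M hφ)).trans ?_
    have h := not_holds_dual .ae H fun s => ¬ M s
    simpa only [AltFlag.dual, not_not] using h

/-- The second-order formula for a prenex formula, over the variables enumerated by `x`. -/
noncomputable def interpretation (p : List (QuantEntry Var)) (ψ : ADFFormula L Var)
    (x : Fin n → Var) (α : AltFlag) : SOFormula (L.sum (freshLanguage (n + 1))) :=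
  (holdsFormula (ψ.toSO (prefixDomain p (Set.range x))
    (skolemTerms p 0 (Set.range x) (initialTerms L x))) α).addPrefix p 0 (Set.range x)

theorem evalAsg_initialTerms [L.Structure A] (x : Fin n → Var) (T : Set (Fin (n + 1) → A))
    (e : SOEnv A) (v : Fin n → A) :
    letI := expansion L T
    evalAsg (e.setTuple v) (Set.range x) (initialTerms L x) = ofTuple x v := by
  funext y
  by_cases h : ∃ i, x i = y
  · have h' : y ∈ Set.range x := h
    simp [evalAsg, ofTuple, if_pos h', dif_pos h, initialTerms, SOTerm.eval, SOEnv.setTuple]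
  · have h' : y ∉ Set.range x := h
    simp only [evalAsg, ofTuple, h', if_false, dif_neg h]

theorem sat_interpretation [Nonempty A] [L.Structure A] (p : List (QuantEntry Var))
    (ψ : ADFFormula L Var) (hψ : ψ.IsQuantifierFree) {x : Fin n → Var}
    (hx : Function.Injective x) {H : Hyperteam Var A} (hH : H.Over (Set.range x)) (hnull : ∅ ∉ H)
    {T : Set (Fin (n + 1) → A)} (hT : IsRelationalEncoding x H T) (α : AltFlag) (e : SOEnv A) :
    letI := expansion L T
    (interpretation p ψ x α).Sat e ↔ Sat (prenex p ψ) α H := by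
  rw [sat_prenex_iff p ψ hψ]
  let := expansion L T
  refine sat_addPrefix p 0 (Set.range x) _ _ ?_ ?_ e
  · intro g g' h
    cases α
    · exact fun ⟨X, hX, hM⟩ => ⟨X, hX, fun s hs => by
        beta_reduce
        rw [← h s (hH X hX s hs)]
        exact hM s hs⟩
    · exact fun h' X hX => (h' X hX).imp fun s ⟨hs, hM⟩ => ⟨hs, by
        beta_reduce
        rwa [← h s (hH X hX s hs)]⟩
  · intro e
    refine sat_holdsFormula hx hH hnull hT _
      (fun s => ψ.SatAt (e.transform p 0 (Set.range x) s)) e (fun a v => ?_) α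
    -- The Skolem terms evaluate to the transformation applied to the tuple's assignment; changing
    -- individual variables leaves that transformation alone, as it reads only function variables.
    rw [sat_toSO, ← transform_evalAsg, evalAsg_initialTerms,
      SOEnv.transform_congr (e := (e.setInd n a).setTuple v) (e' := e) rfl]

end Sentences

end ADFLogic

theorem mainTheorem10 {L : FirstOrder.Language.{uF, uR}} [L.IsRelational]
    {Var : Type uV} [DecidableEq Var]
    (p : List (QuantEntry Var)) (hp : AdmissiblePref p)
    (ψ : ADFFormula L Var) (hψ : ψ.IsQuantifierFree)
    (V : Finset Var) (hV : (prenex p ψ).free ⊆ V) (hpV : ∀ e ∈ p, e.x ∉ V)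
    {n : ℕ} (x : Fin n → Var) (hx : Function.Injective x) (hxV : Set.range x = (V : Set Var)) :
    ∃ Φ : AltFlag → SOSentence (L.sum (freshLanguage (n + 1))),
      ∀ (A : Type uA) [Nonempty A] [L.Structure A] (H : Hyperteam Var A),
        H.Over (V : Set Var) → ∅ ∉ H →
        Cardinal.mk H ≤ Cardinal.lift.{uV} (Cardinal.mk A) →
        (∃ T : Set (Fin (n + 1) → A), IsRelationalEncoding x H T) ∧
        ∀ T : Set (Fin (n + 1) → A), IsRelationalEncoding x H T →
          ∀ α : AltFlag,
            (Sat (prenex p ψ) α H ↔ (Φ α).TrueIn (expansion L T)) := by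
  refine ⟨fun α => (interpretation p ψ x α).closure, fun A _ _ H hH hnull hcard =>
    ⟨exists_isRelationalEncoding hx H hcard, fun T hT α => ?_⟩⟩
  rw [← hxV] at hH
  exact (trueIn_closure_iff (expansion L T) _ _
    (sat_interpretation p ψ hψ hx hH hnull hT α)).symm
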